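/- Linearly ordered posets are triples $(A,\sqsubseteq,<)$ where $\sqsubseteq$ is a partial order on $A$ and $<$ is a linear order on $A$ such that $a\sqsubseteq b$ and $a\ne b$ imply $a<b$; an embedding is an injective map that preserves and reflects both $\sqsubseteq$ and $<$. For $n\ge 1$ let $$\Pi_n=\big(\mathcal P(\{1,\dots,n\}),\ \supseteq,\ <_{\overline{\mathrm{lex}}}\big),$$ where $X<_{\overline{\mathrm{lex}}}Y$ iff either $X\supsetneq Y$, or $X,Y$ are incomparable under inclusion and $\min(X\setminus Y)<\min(Y\setminus X)$. A class $\mathbf K^*$ of finite linearly ordered posets, with $\mathbf K=\{(A,\sqsubseteq) : (A,\sqsubseteq,<)\in\mathbf K^*\text{ for some linear order }<\}$, has the ordering property if for every $(A,\sqsubseteq_A)\in\mathbf K$ there is a $(B,\sqsubseteq_B)\in\mathbf K$ such that for every linear order $<_A$ on $A$ with $(A,\sqsubseteq_A,<_A)\in\mathbf K^*$ and every linear order $<_B$ on $B$ with $(B,\sqsubseteq_B,<_B)\in\mathbf K^*$ there is an embedding of $(A,\sqsubseteq_A,<_A)$ into $(B,\sqsubseteq_B,<_B)$. **Theorem.**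 Let $\mathbf K^*$ be any class of finite linearly ordered posets such that $\Pi_n\in\mathbf K^*$ for all $n\ge 1$. Then $\mathbf K^*$ has the ordering property. In particular, the class of all finite linearly ordered posets has the ordering property. -/

import Mathlib

universe u

/-- A structure with one binary relation `rel` (no axioms). -/
structure RelStr where
  carrier : Type u
  rel : carrier → carrier → Prop

/-- A structure with one binary relation `rel`, expanded by a (strict) linear order `lt`. -/
structure OrdRelStr extends RelStr.{u} where
  lt : carrier → carrier → Prop
  isStrictTotalOrder : IsStrictTotalOrder carrier lt

namespace OrdRelStr

/-- An embedding of ordered structures: an injective map that preserves and reflects both the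
relation and the linear order. -/
structure Embedding (A B : OrdRelStr.{u}) where
  toFun : A.carrier → B.carrier
  injective : Function.Injective toFun
  rel_iff : ∀ a b, A.rel a b ↔ B.rel (toFun a) (toFun b)
  lt_iff : ∀ a b, A.lt a b ↔ B.lt (toFun a) (toFun b)

/-- `A` embeds into `B`. -/
def Embeds (A B : OrdRelStr.{u}) : Prop := Nonempty (Embedding A B)

/-- Linearly ordered posets: `rel` is a partial order and the linear order extends it. -/
structure IsLinearlyOrderedPoset (A : OrdRelStr.{u}) : Prop where
  refl : ∀ a, A.rel a a
  antisymm : ∀ a b, A.rel a b → A.rel b a → a = b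
  trans : ∀ a b c, A.rel a b → A.rel b c → A.rel a c
  lt_of_rel : ∀ a b, A.rel a b → a ≠ b → A.lt a b

end OrdRelStr

/-- The class of all finite linearly ordered posets. -/
def finLinOrdPosets : Set OrdRelStr.{u} :=
  {A | Finite A.carrier ∧ A.IsLinearlyOrderedPoset}

/-- The class of reducts of a class of ordered structures (forget the linear order). -/
def reducts (K : Set OrdRelStr.{u}) : Set RelStr.{u} :=
  {A | ∃ (lt : A.carrier → A.carrier → Prop) (h : IsStrictTotalOrder A.carrier lt),
    OrdRelStr.mk A lt h ∈ K}

/-- `B` is a witness for the ordering property for `A` with respect to the class `K`. -/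
def IsOrderingWitness (K : Set OrdRelStr.{u}) (A B : RelStr.{u}) : Prop :=
  ∀ (ltA : A.carrier → A.carrier → Prop) (hA : IsStrictTotalOrder A.carrier ltA),
    OrdRelStr.mk A ltA hA ∈ K →
  ∀ (ltB : B.carrier → B.carrier → Prop) (hB : IsStrictTotalOrder B.carrier ltB),
    OrdRelStr.mk B ltB hB ∈ K →
  (OrdRelStr.mk A ltA hA).Embeds (OrdRelStr.mk B ltB hB)

/-- The ordering property of a class `K` of ordered structures. -/
def OrderingProperty (K : Set OrdRelStr.{u}) : Prop :=
  ∀ A ∈ reducts K, ∃ B ∈ reducts K, IsOrderingWitness K A B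

/-- The strict complemented lexicographic order on finite sets of naturals: `A` precedes `B` if
`A` properly contains `B`, or if `A`, `B` are incomparable and `min (A \ B) < min (B \ A)`. -/
def complLexLT (A B : Finset ℕ) : Prop :=
  B ⊂ A ∨ (¬ A ⊆ B ∧ ¬ B ⊆ A ∧ (A \ B).min < (B \ A).min)

theorem complLexLT_iff (A B : Finset ℕ) :
    complLexLT A B ↔ ∃ m, m ∈ A ∧ m ∉ B ∧ ∀ k < m, (k ∈ A ↔ k ∈ B) := by
  constructor
  · intro h
    have hne : (A \ B).Nonempty := by
      rw [Finset.sdiff_nonempty]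
      rcases h with h | h
      · exact h.2
      · exact h.1
    have hlt : (A \ B).min < (B \ A).min := by
      rcases h with h | h
      · rw [Finset.sdiff_eq_empty_iff_subset.mpr h.1, Finset.min_empty,
          ← Finset.coe_min' hne]
        exact WithTop.coe_lt_top _
      · exact h.2.2
    rw [← Finset.coe_min' hne] at hlt
    have hm := Finset.mem_sdiff.mp (Finset.min'_mem _ hne)
    refine ⟨_, hm.1, hm.2, fun k hk => ⟨fun ha => ?_, fun hb => ?_⟩⟩
    · by_contra hb
      exact absurd (Finset.min'_le _ k (Finset.mem_sdiff.mpr ⟨ha, hb⟩)) (not_le.mpr hk)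
    · by_contra ha
      have h1 := Finset.min_le (Finset.mem_sdiff.mpr ⟨hb, ha⟩)
      exact absurd (WithTop.coe_lt_coe.mp (lt_of_lt_of_le hlt h1)) (not_lt.mpr hk.le)
  · rintro ⟨m, hA, hB, hk⟩
    have h1 : ¬ A ⊆ B := fun h => hB (h hA)
    by_cases h2 : B ⊆ A
    · exact Or.inl ⟨h2, h1⟩
    · refine Or.inr ⟨h1, h2, ?_⟩
      have hne : (B \ A).Nonempty := Finset.sdiff_nonempty.mpr h2
      refine lt_of_le_of_lt (Finset.min_le (Finset.mem_sdiff.mpr ⟨hA, hB⟩)) ?_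
      rw [← Finset.coe_min' hne]
      refine WithTop.coe_lt_coe.mpr ?_
      have hm := Finset.mem_sdiff.mp (Finset.min'_mem _ hne)
      by_contra hle
      rcases (not_lt.mp hle).lt_or_eq with h | h
      · exact hm.2 ((hk _ h).mpr hm.1)
      · exact hm.2 (h ▸ hA)

theorem complLexLT_irrefl (A : Finset ℕ) : ¬ complLexLT A A := by
  rw [complLexLT_iff]
  rintro ⟨m, h1, h2, -⟩
  exact h2 h1

theorem complLexLT_trans {A B C : Finset ℕ} (h1 : complLexLT A B) (h2 : complLexLT B C) :
    complLexLT A C := by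
  rw [complLexLT_iff] at *
  obtain ⟨m, ma, mb, hm⟩ := h1
  obtain ⟨l, lb, lc, hl⟩ := h2
  rcases lt_trichotomy m l with h | h | h
  · exact ⟨m, ma, fun hc => mb ((hl m h).mpr hc), fun k hk => (hm k hk).trans (hl k (hk.trans h))⟩
  · subst h
    exact absurd lb mb
  · exact ⟨l, (hm l h).mpr lb, lc, fun k hk => (hm k (hk.trans h)).trans (hl k hk)⟩

theorem complLexLT_total {A B : Finset ℕ} (h : A ≠ B) : complLexLT A B ∨ complLexLT B A := by
  classical
  have hex : ∃ m, ¬ (m ∈ A ↔ m ∈ B) := by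
    by_contra hn
    push Not at hn
    exact h (Finset.ext hn)
  have hs := Nat.find_spec hex
  have hlt : ∀ k < Nat.find hex, (k ∈ A ↔ k ∈ B) := fun k hk => not_not.mp (Nat.find_min hex hk)
  rw [complLexLT_iff, complLexLT_iff]
  by_cases ha : Nat.find hex ∈ A
  · exact Or.inl ⟨_, ha, fun hb => hs ⟨fun _ => hb, fun _ => ha⟩, hlt⟩
  · have hb : Nat.find hex ∈ B := by
      by_contra hb
      exact hs ⟨fun h => absurd h ha, fun h => absurd h hb⟩
    exact Or.inr ⟨_, hb, ha, fun k hk => (hlt k hk).symm⟩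

/-- `Π_n`: all subsets of `{1, …, n}` under reverse inclusion, with the complemented
lexicographic order. (`ULift` only places the carrier in the universe `u`.) -/
def powersetPoset (n : ℕ) : OrdRelStr.{u} where
  carrier := ULift.{u} {A : Finset ℕ // A ⊆ Finset.Icc 1 n}
  rel A B := B.down.1 ⊆ A.down.1
  lt A B := complLexLT A.down.1 B.down.1
  isStrictTotalOrder :=
    { irrefl := fun A => complLexLT_irrefl _
      trans := fun _ _ _ h1 h2 => complLexLT_trans h1 h2
      trichotomous := fun A B h1 h2 => by
        by_contra hne
        rcases complLexLT_total (A := A.down.1) (B := B.down.1)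
          (fun h => hne (ULift.ext _ _ (Subtype.ext h))) with h | h
        · exact h1 h
        · exact h2 h }

/-!
The witness for `A` is a large power set ordered by `⊇`. It contains a copy of a large grid
`Fin M ^ d` with the product order (a point goes to the set of cells above it), so it suffices to
find `(A, ⊑, <)` inside every linear extension of such a grid.

Only *generic* pairs of grid points, those that differ in every coordinate, are needed. The product
Ramsey theorem for pairs gives a subgrid on which the order of a generic pair `x, y` depends only on
the sign pattern `{j | x j < y j}`. Transitivity and totality say that the patterns for which `x`
precedes `y` form an ultrafilter on the finite set of coordinates; it is principal, so one
coordinate `i` decides the order of all generic pairs (`exists_decisive_coordinate`).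

A finite linearly ordered poset embeds into a grid with any two points in generic position: one
coordinate is the rank with respect to `<`, and for each `a` there is another in which the elements
`⊒ a` are shifted above all the others (`realizerRank`). Since the coordinates of the grid can be
permuted, the rank can be made the decisive coordinate `i`; then the given linear extension of the
grid induces exactly `<` on the copy of `A`.
-/

/-! ### Ramsey's theorem for pairs -/

theorem exists_end_homogeneous (κ : Type*) [Finite κ] (n : ℕ) :
    ∃ M, ∀ (S : Finset ℕ) (c : ℕ → ℕ → κ), M ≤ S.card →
      ∃ T ⊆ S, T.card = n ∧ ∃ f : ℕ → κ, ∀ i ∈ T, ∀ j ∈ T, i < j → c i j = f i := by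
  classical
  have := Fintype.ofFinite κ
  induction n with
  | zero => exact ⟨0, fun S c _ => ⟨∅, by simp, rfl, fun i => c i i, by simp⟩⟩
  | succ n ih =>
    obtain ⟨M, hM⟩ := ih
    refine ⟨Fintype.card κ * M + 1, fun S c hS => ?_⟩
    have hne : S.Nonempty := Finset.card_pos.mp (by omega)
    set s := S.min' hne
    have hsS : s ∈ S := S.min'_mem hne
    have : Nonempty κ := ⟨c 0 0⟩
    obtain ⟨k, -, hk⟩ := Finset.exists_le_card_fiber_of_mul_le_card_of_maps_to
      (s := S.erase s) (t := Finset.univ) (f := c s) (n := M) (fun _ _ => Finset.mem_univ _)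
      Finset.univ_nonempty (by rw [Finset.card_erase_of_mem hsS, Finset.card_univ]; omega)
    obtain ⟨T, hTS, hT, f, hf⟩ := hM _ c hk
    have hmem : ∀ j ∈ T, (j ≠ s ∧ j ∈ S) ∧ c s j = k := fun j hj => by simpa using hTS hj
    have hlt : ∀ j ∈ T, s < j := fun j hj =>
      lt_of_le_of_ne (S.min'_le j (hmem j hj).1.2) (hmem j hj).1.1.symm
    have hsT : s ∉ T := fun h => lt_irrefl _ (hlt s h)
    refine ⟨insert s T, Finset.insert_subset hsS fun j hj => (hmem j hj).1.2,
      by rw [Finset.card_insert_of_notMem hsT, hT], Function.update f s k, ?_⟩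
    intro i hi j hj hij
    rcases Finset.mem_insert.mp hi with rfl | hi
    · rcases Finset.mem_insert.mp hj with rfl | hj
      · exact absurd hij (lt_irrefl _)
      · rw [Function.update_self, (hmem j hj).2]
    · rcases Finset.mem_insert.mp hj with rfl | hj
      · exact absurd hij (hlt i hi).not_gt
      · rw [Function.update_of_ne (hmem i hi).1.1, hf i hi j hj hij]

theorem exists_homogeneous (κ : Type*) [Finite κ] (m : ℕ) :
    ∃ M₀, ∀ M, M₀ ≤ M → ∀ c : Fin M → Fin M → κ,
      ∃ h : Fin m → Fin M, StrictMono h ∧ ∃ k, ∀ a b, a < b → c (h a) (h b) = k := by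
  classical
  have := Fintype.ofFinite κ
  obtain ⟨M₀, hM₀⟩ := exists_end_homogeneous κ (Fintype.card κ * m)
  refine ⟨M₀ + 1, fun M hM c => ?_⟩
  have : NeZero M := ⟨by omega⟩
  have : Nonempty κ := ⟨c 0 0⟩
  obtain ⟨T, hTS, hT, f, hf⟩ := hM₀ (Finset.range M)
    (fun i j => c (Fin.ofNat M i) (Fin.ofNat M j)) (by simp; omega)
  obtain ⟨k, -, hk⟩ := Finset.exists_le_card_fiber_of_mul_le_card_of_maps_to
      (s := T) (t := Finset.univ) (f := f) (n := m) (fun _ _ => Finset.mem_univ _)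
      Finset.univ_nonempty (by rw [hT, Finset.card_univ])
  obtain ⟨U, hU, hUm⟩ := Finset.exists_subset_card_eq hk
  have hmem : ∀ a, U.orderEmbOfFin hUm a ∈ T ∧ f (U.orderEmbOfFin hUm a) = k := fun a =>
    Finset.mem_filter.mp (hU (U.orderEmbOfFin_mem hUm a))
  have hlt : ∀ a, U.orderEmbOfFin hUm a < M := fun a => Finset.mem_range.mp (hTS (hmem a).1)
  refine ⟨fun a => ⟨_, hlt a⟩, fun a b hab => (U.orderEmbOfFin hUm).strictMono hab, k,
    fun a b hab => ?_⟩
  have h := hf _ (hmem a).1 _ (hmem b).1 ((U.orderEmbOfFin hUm).strictMono hab)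
  rw [(hmem a).2] at h
  rw [← h]
  congr 1 <;> exact Fin.ext (Nat.mod_eq_of_lt (hlt _)).symm

/-- The product Ramsey theorem for pairs. A box in the grid is given by its least corner `a` and
its greatest corner `b`; all boxes of some subgrid of side `m` have the same colour. -/
theorem exists_homogeneous_subgrid (κ : Type*) [Finite κ] (m d : ℕ) :
    ∃ M, ∀ c : (Fin d → Fin M) → (Fin d → Fin M) → κ,
      ∃ h : Fin d → Fin m → Fin M, (∀ j, StrictMono (h j)) ∧
        ∃ k, ∀ a b : Fin d → Fin m, (∀ j, a j < b j) →
          c (fun j => h j (a j)) (fun j => h j (b j)) = k := by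
  induction d with
  | zero =>
    exact ⟨0, fun c => ⟨Fin.elim0, fun j => j.elim0, c Fin.elim0 Fin.elim0, fun a b _ => by
      congr 1 <;> exact Subsingleton.elim _ _⟩⟩
  | succ d ih =>
    obtain ⟨M₁, hM₁⟩ := ih
    -- A pair in the first coordinate is coloured by the colouring it induces on the remaining grid.
    obtain ⟨M₂, hM₂⟩ := exists_homogeneous ((Fin d → Fin M₁) → (Fin d → Fin M₁) → κ) m
    have hle : M₁ ≤ max M₁ M₂ := le_max_left _ _
    refine ⟨max M₁ M₂, fun c => ?_⟩
    obtain ⟨h₀, hh₀, g, hg⟩ := hM₂ _ (le_max_right M₁ M₂) fun p q a b =>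
      c (Fin.cons p fun j => Fin.castLE hle (a j)) (Fin.cons q fun j => Fin.castLE hle (b j))
    obtain ⟨h, hh, k, hk⟩ := hM₁ g
    refine ⟨Fin.cons h₀ fun j a => Fin.castLE hle (h j a), ?_, k, fun a b hab => ?_⟩
    · refine Fin.cases ?_ fun j => ?_
      · simpa using hh₀
      · intro a b hab
        simpa using hh j hab
    · rw [← hk (fun j => a j.succ) (fun j => b j.succ) fun j => hab j.succ,
        ← hg (a 0) (b 0) (hab 0)]
      congr 1 <;> ext j <;> refine Fin.cases ?_ (fun j => ?_) j <;> simp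

/-! ### Linear extensions of grids -/

theorem exists_pattern_family (d m : ℕ) :
    ∃ M, ∀ lt : (Fin d → Fin M) → (Fin d → Fin M) → Prop,
      ∃ h : Fin d → Fin m → Fin M, (∀ j, StrictMono (h j)) ∧ ∃ F : Set (Set (Fin d)),
        ∀ x y : Fin d → Fin m, (∀ j, x j ≠ y j) →
          (lt (fun j => h j (x j)) (fun j => h j (y j)) ↔ {j | x j < y j} ∈ F) := by
  classical
  obtain ⟨M, hM⟩ := exists_homogeneous_subgrid (Set (Set (Fin d))) m d
  refine ⟨M, fun lt => ?_⟩
  -- A pattern `s` singles out a diagonal of the box with extreme corners `a` and `b`.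
  obtain ⟨h, hh, F, hF⟩ := hM fun a b =>
    {s | lt (fun j => if j ∈ s then a j else b j) (fun j => if j ∈ s then b j else a j)}
  refine ⟨h, hh, F, fun x y hxy => ?_⟩
  rw [← hF (fun j => min (x j) (y j)) (fun j => max (x j) (y j))
    fun j => min_lt_max.mpr (hxy j), Set.mem_ofPred_eq]
  congr! 2 with j j <;> by_cases hj : x j < y j
  · simp [hj, hj.le]
  · simp [hj, not_lt.mp hj]
  · simp [hj, hj.le]
  · simp [hj, not_lt.mp hj]

/-- In every linear extension of a large grid there is a subgrid of side `m` in which a single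
coordinate decides the order of all pairs of points that differ in every coordinate. -/
theorem exists_decisive_coordinate (d m : ℕ) (hd : 0 < d) (hm : 3 ≤ m) :
    ∃ M, ∀ lt : (Fin d → Fin M) → (Fin d → Fin M) → Prop, IsStrictTotalOrder _ lt →
      (∀ x y, x ≤ y → x ≠ y → lt x y) →
      ∃ h : Fin d → Fin m → Fin M, (∀ j, StrictMono (h j)) ∧ ∃ i : Fin d,
        ∀ x y : Fin d → Fin m, (∀ j, x j ≠ y j) → x i < y i →
          lt (fun j => h j (x j)) (fun j => h j (y j)) := by
  classical
  obtain ⟨M, hM⟩ := exists_pattern_family d m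
  refine ⟨M, fun lt hlt hext => ?_⟩
  obtain ⟨h, hh, F, hF⟩ := hM lt
  refine ⟨h, hh, ?_⟩
  let j₀ : Fin d := ⟨0, hd⟩
  let p : Fin m := ⟨0, by omega⟩
  let q : Fin m := ⟨1, by omega⟩
  let r : Fin m := ⟨2, by omega⟩
  have hpq : p < q := by simp [p, q]
  have hqr : q < r := by simp [q, r]
  have hpr : p < r := hpq.trans hqr
  have huniv : Set.univ ∈ F := by
    have h1 := hF (fun _ => p) (fun _ => q) fun _ => hpq.ne
    simp only [hpq, Set.ofPred_true] at h1
    exact h1.mp (hext _ _ (fun j => (hh j hpq).le) fun he =>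
      (hh j₀ hpq).ne (congrFun he j₀))
  -- If `x, y` has pattern `s` and `y, z` has pattern `t`, then the pattern of `x, z` can be any
  -- `u` between `s ∩ t` and `s ∪ t`: three values per coordinate suffice to realize it.
  have hclosed : ∀ s ∈ F, ∀ t ∈ F, ∀ u, s ∩ t ⊆ u → u ⊆ s ∪ t → u ∈ F := by
    intro s hs t ht u h1 h2
    let x : Fin d → Fin m := fun j =>
      if j ∈ s then (if j ∈ t then p else if j ∈ u then p else q)
      else if j ∈ t then (if j ∈ u then q else r) else r
    let y : Fin d → Fin m := fun j =>
      if j ∈ s then (if j ∈ t then q else r) else if j ∈ t then p else q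
    let z : Fin d → Fin m := fun j =>
      if j ∈ s then (if j ∈ t then r else if j ∈ u then q else p)
      else if j ∈ t then (if j ∈ u then r else q) else p
    have key : ∀ j, (x j ≠ y j ∧ (x j < y j ↔ j ∈ s)) ∧ (y j ≠ z j ∧ (y j < z j ↔ j ∈ t)) ∧
        (x j ≠ z j ∧ (x j < z j ↔ j ∈ u)) := by
      intro j
      have h1 : j ∈ s → j ∈ t → j ∈ u := fun a b => h1 ⟨a, b⟩
      have h2 : j ∈ u → j ∈ s ∨ j ∈ t := fun a => h2 a
      by_cases js : j ∈ s <;> by_cases jt : j ∈ t <;> by_cases ju : j ∈ u <;>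
        simp_all [x, y, z, hpq.ne, hqr.ne, hpr.ne, hpq.ne', hqr.ne', hpr.ne', hpq.not_gt,
          hqr.not_gt, hpr.not_gt, -Fin.mk.injEq]
    have hxy := hF x y fun j => (key j).1.1
    have hyz := hF y z fun j => (key j).2.1.1
    have hxz := hF x z fun j => (key j).2.2.1
    rw [show {j | x j < y j} = s from Set.ext fun j => (key j).1.2] at hxy
    rw [show {j | y j < z j} = t from Set.ext fun j => (key j).2.1.2] at hyz
    rw [show {j | x j < z j} = u from Set.ext fun j => (key j).2.2.2] at hxz
    exact hxz.mp (hlt.trans _ _ _ (hxy.mpr hs) (hyz.mpr ht))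
  let f : Filter (Fin d) :=
    { sets := F
      univ_sets := huniv
      sets_of_superset := fun {s u} hs hsu => hclosed s hs _ huniv u (by simpa using hsu) (by simp)
      inter_sets := fun {s t} hs ht => hclosed s hs t ht _ subset_rfl
        (Set.inter_subset_left.trans Set.subset_union_left) }
  have hcompl : ∀ s, sᶜ ∉ f ↔ s ∈ f := by
    intro s
    let x : Fin d → Fin m := fun j => if j ∈ s then p else q
    let y : Fin d → Fin m := fun j => if j ∈ s then q else p
    have key : ∀ j, x j ≠ y j ∧ (x j < y j ↔ j ∈ s) ∧ (y j < x j ↔ j ∈ sᶜ) := by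
      intro j
      by_cases js : j ∈ s <;> simp [x, y, js, hpq, hpq.ne, hpq.ne', hpq.not_gt, -Fin.mk.injEq]
    have hxy := hF x y fun j => (key j).1
    have hyx := hF y x fun j => (key j).1.symm
    rw [show {j | x j < y j} = s from Set.ext fun j => (key j).2.1] at hxy
    rw [show {j | y j < x j} = sᶜ from Set.ext fun j => (key j).2.2] at hyx
    change sᶜ ∉ F ↔ s ∈ F
    rw [← hxy, ← hyx]
    constructor
    · intro hn
      by_contra hn'
      exact (key j₀).1 ((hh j₀).injective (congrFun (hlt.trichotomous _ _ hn' hn) j₀))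
    · exact fun h1 h2 => hlt.irrefl _ (hlt.trans _ _ _ h1 h2)
  obtain ⟨i, hi⟩ := (Ultrafilter.ofComplNotMemIff f hcompl).eq_pure_of_finite
  refine ⟨i, fun x y hxy hlt' => (hF x y hxy).mpr ?_⟩
  have hmem : {j | x j < y j} ∈ Ultrafilter.ofComplNotMemIff f hcompl := by
    rw [hi]
    exact hlt'
  exact hmem

/-! ### Embedding grids into power sets -/

/-- The up-set `{(j, k) | x j ≤ k}` of a grid point `x`, with the cells of the grid coded as
positive integers. -/
noncomputable def gridUpset {d M : ℕ} (x : Fin d → Fin M) : Finset ℕ :=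
  (Finset.univ.filter fun c : Fin d × Fin M => x c.1 ≤ c.2).image
    fun c => (finProdFinEquiv c : ℕ) + 1

theorem gridUpset_subset_Icc {d M : ℕ} (x : Fin d → Fin M) :
    gridUpset x ⊆ Finset.Icc 1 (d * M + 1) := by
  intro k hk
  obtain ⟨c, -, rfl⟩ := Finset.mem_image.mp hk
  have := (finProdFinEquiv c).isLt
  rw [Finset.mem_Icc]
  omega

theorem gridUpset_subset_iff {d M : ℕ} (x y : Fin d → Fin M) :
    gridUpset y ⊆ gridUpset x ↔ x ≤ y := by
  have hinj : Function.Injective fun c : Fin d × Fin M => (finProdFinEquiv c : ℕ) + 1 :=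
    fun a b hab => finProdFinEquiv.injective (Fin.ext (Nat.succ_injective hab))
  rw [gridUpset, gridUpset, Finset.image_subset_image_iff hinj]
  constructor
  · intro h j
    have := @h (j, y j) (by simp)
    simpa using this
  · intro h c hc
    simp only [Finset.mem_filter, Finset.mem_univ, true_and] at hc ⊢
    exact (h c.1).trans hc

/-! ### Realizers of linearly ordered posets -/

section Realizer

variable {α : Type*} [Fintype α]

/-- The number of elements below `x` in the strict order `lt`. -/
noncomputable def ltRank (lt : α → α → Prop) (x : α) : ℕ :=
  by classical exact (Finset.univ.filter fun y => lt y x).card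

theorem ltRank_lt_card {lt : α → α → Prop} (hlt : IsStrictTotalOrder α lt) (x : α) :
    ltRank lt x < Fintype.card α := by
  classical
  refine Finset.card_lt_univ_of_notMem (x := x) ?_
  simpa using hlt.irrefl x

theorem ltRank_lt_ltRank {lt : α → α → Prop} (hlt : IsStrictTotalOrder α lt) {x y : α}
    (hxy : lt x y) : ltRank lt x < ltRank lt y := by
  classical
  refine Finset.card_lt_card ⟨fun z hz => ?_, fun hsub => ?_⟩
  · simp only [Finset.mem_filter, Finset.mem_univ, true_and] at hz ⊢
    exact hlt.trans _ _ _ hz hxy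
  · have := @hsub x (by simpa using hxy)
    exact hlt.irrefl x (by simpa using this)

/-- The coordinates of a grid embedding of a linearly ordered poset: `none` gives the rank in the
linear order, and `some a` gives the rank in the linear order obtained by moving the elements
above `a` past all the others. -/
noncomputable def realizerRank (rel lt : α → α → Prop) : Option α → α → ℕ
  | none, x => ltRank lt x
  | some a, x => by classical exact ltRank lt x + if rel a x then Fintype.card α else 0

variable {rel lt : α → α → Prop}

theorem realizerRank_lt (hlt : IsStrictTotalOrder α lt) (o : Option α) (x : α) :
    realizerRank rel lt o x < 2 * Fintype.card α := by
  have := ltRank_lt_card hlt x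
  cases o <;> simp only [realizerRank]
  · omega
  · split <;> omega

theorem realizerRank_injective (hlt : IsStrictTotalOrder α lt) (o : Option α) :
    Function.Injective (realizerRank rel lt o) := by
  intro x y hxy
  have hx := ltRank_lt_card hlt x
  have hy := ltRank_lt_card hlt y
  have he : ltRank lt x = ltRank lt y := by
    cases o <;> simp only [realizerRank] at hxy
    · exact hxy
    · split at hxy <;> split at hxy <;> omega
  by_contra hne
  have h1 : ¬ lt x y := fun h => (ltRank_lt_ltRank hlt h).ne he
  have h2 : ¬ lt y x := fun h => (ltRank_lt_ltRank hlt h).ne' he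
  exact hne (hlt.trichotomous _ _ h1 h2)

theorem forall_realizerRank_le_iff (hlt : IsStrictTotalOrder α lt) (hrefl : ∀ a, rel a a)
    (htrans : ∀ a b c, rel a b → rel b c → rel a c) (hext : ∀ a b, rel a b → a ≠ b → lt a b)
    (x y : α) :
    (∀ o, realizerRank rel lt o x ≤ realizerRank rel lt o y) ↔ rel x y := by
  constructor
  · intro h
    by_contra hxy
    have hx := h (some x)
    have hy := ltRank_lt_card hlt y
    simp only [realizerRank, hrefl, hxy, if_true, if_false] at hx
    omega
  · intro hxy
    have hle : ltRank lt x ≤ ltRank lt y := by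
      by_cases he : x = y
      · rw [he]
      · exact (ltRank_lt_ltRank hlt (hext x y hxy he)).le
    rintro (_ | a)
    · exact hle
    · simp only [realizerRank]
      by_cases ha : rel a x
      · simpa [ha, htrans a x y ha hxy] using hle
      · simp only [ha, if_false]
        omega

end Realizer

/-! ### The ordering property -/

theorem powersetPoset_mem_finLinOrdPosets (n : ℕ) : powersetPoset.{u} n ∈ finLinOrdPosets := by
  refine ⟨?_, ?_, ?_, ?_, ?_⟩
  · have : Finite {A : Finset ℕ // A ⊆ Finset.Icc 1 n} :=
      Finite.of_injective (β := (Finset.Icc 1 n).powerset)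
        (fun A => ⟨A.1, Finset.mem_powerset.mpr A.2⟩)
        fun A B h => Subtype.ext (congrArg (fun z => z.1) h)
    exact inferInstanceAs (Finite (ULift _))
  · exact fun A => subset_rfl (a := A.down.1)
  · exact fun A B h1 h2 => ULift.ext _ _ (Subtype.ext (subset_antisymm h2 h1))
  · exact fun A B C h1 h2 => Finset.Subset.trans h2 h1
  · exact fun A B h hne => Or.inl ⟨h, fun h' =>
      hne (ULift.ext _ _ (Subtype.ext (subset_antisymm h' h)))⟩

/-- The size of the power set in the witness depends only on the size of `A`, so that one witness
serves all linear orders on `A`. -/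
theorem exists_embeds_of_reduct_powersetPoset (n : ℕ) :
    ∃ N, 1 ≤ N ∧ ∀ A : OrdRelStr.{u}, A ∈ finLinOrdPosets → Nat.card A.carrier = n →
      ∀ B : OrdRelStr.{u}, B.toRelStr = (powersetPoset.{u} N).toRelStr →
        B.IsLinearlyOrderedPoset → A.Embeds B := by
  obtain ⟨M, hM⟩ := exists_decisive_coordinate (n + 1) (2 * n + 3) (by omega) (by omega)
  refine ⟨(n + 1) * M + 1, by omega, ?_⟩
  rintro ⟨⟨α, rel⟩, lt, hlt⟩ ⟨hfin, hA⟩ hcard ⟨B, ltB, hltB⟩ hBeq hB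
  obtain rfl : B = _ := hBeq
  obtain ⟨hrefl, -, htrans, hext⟩ := hA
  have hfin' : Finite α := hfin
  have := Fintype.ofFinite α
  replace hcard : Fintype.card α = n := by rw [← Nat.card_eq_fintype_card]; exact hcard
  let g : (Fin (n + 1) → Fin M) → (powersetPoset.{u} ((n + 1) * M + 1)).carrier := fun x =>
    ⟨gridUpset x, gridUpset_subset_Icc x⟩
  have hgrel : ∀ x y, (powersetPoset.{u} ((n + 1) * M + 1)).rel (g x) (g y) ↔ x ≤ y :=
    gridUpset_subset_iff
  have hg : Function.Injective g := fun x y hxy =>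
    le_antisymm ((hgrel x y).mp (hxy ▸ hB.refl (g x))) ((hgrel y x).mp (hxy ▸ hB.refl (g x)))
  obtain ⟨h, hh, i, hi⟩ := hM (fun x y => ltB (g x) (g y))
    { irrefl := fun x => hltB.irrefl _
      trans := fun _ _ _ => hltB.trans _ _ _
      trichotomous := fun x y h1 h2 => hg (hltB.trichotomous _ _ h1 h2) }
    fun x y hxy hne => hB.lt_of_rel _ _ ((hgrel x y).mpr hxy) (hg.ne hne)
  -- The coordinates are labelled so that the rank in `<` sits at the decisive coordinate `i`.
  obtain ⟨e, he⟩ : ∃ e : Fin (n + 1) ≃ Option α, e i = none := by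
    classical
    let e₀ : Fin (n + 1) ≃ Option α := Fintype.equivOfCardEq (by simp [hcard])
    exact ⟨e₀.trans (Equiv.swap (e₀ i) none), by simp⟩
  let φ : α → Fin (n + 1) → Fin (2 * n + 3) := fun x j =>
    ⟨realizerRank rel lt (e j) x, by
      have := realizerRank_lt (rel := rel) hlt (e j) x
      omega⟩
  have hφ : ∀ {x y}, x ≠ y → ∀ j, φ x j ≠ φ y j := fun hne j heq =>
    hne (realizerRank_injective hlt (e j) (congrArg Fin.val heq))
  let emb : α → (powersetPoset.{u} ((n + 1) * M + 1)).carrier := fun x => g fun j => h j (φ x j)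
  have hlt_emb : ∀ x y, lt x y → ltB (emb x) (emb y) := by
    intro x y hxy
    have hne : x ≠ y := fun heq => hlt.irrefl y (heq ▸ hxy)
    refine hi _ _ (hφ hne) ?_
    change realizerRank rel lt (e i) x < realizerRank rel lt (e i) y
    rw [he]
    exact ltRank_lt_ltRank hlt hxy
  refine ⟨⟨emb, fun x y hxy => ?_, fun x y => ?_, fun x y => ⟨hlt_emb x y, fun hxy => ?_⟩⟩⟩
  · by_contra hne
    exact hφ hne i ((hh i).injective (congrFun (hg hxy) i))
  · refine (forall_realizerRank_le_iff (rel := rel) hlt hrefl htrans hext x y).symm.trans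
      (Iff.trans ?_ (hgrel _ _).symm)
    rw [Pi.le_def, ← e.forall_congr_right]
    exact forall_congr' fun j => ((hh j).le_iff_le (a := φ x j) (b := φ y j)).symm
  · by_contra hn
    by_cases heq : x = y
    · exact hltB.irrefl _ (heq ▸ hxy)
    · have hyx : lt y x := by
        by_contra hn'
        exact heq (hlt.trichotomous _ _ hn hn')
      exact hltB.irrefl _ (hltB.trans _ _ _ hxy (hlt_emb y x hyx))

theorem theorem3p3 :
    (∀ K : Set OrdRelStr.{u}, K ⊆ finLinOrdPosets.{u} →
      (∀ n : ℕ, 1 ≤ n → powersetPoset.{u} n ∈ K) → OrderingProperty K) ∧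
    OrderingProperty finLinOrdPosets.{u} := by
  have main : ∀ K : Set OrdRelStr.{u}, K ⊆ finLinOrdPosets.{u} →
      (∀ n : ℕ, 1 ≤ n → powersetPoset.{u} n ∈ K) → OrderingProperty K := by
    intro K hK hP A _
    obtain ⟨N, hN, h⟩ := exists_embeds_of_reduct_powersetPoset.{u} (Nat.card A.carrier)
    exact ⟨(powersetPoset.{u} N).toRelStr, ⟨_, (powersetPoset.{u} N).isStrictTotalOrder, hP N hN⟩,
      fun ltA hA hAK ltB hB hBK => h _ (hK hAK) rfl _ rfl (hK hBK).2⟩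
  exact ⟨main, main _ subset_rfl fun n _ => powersetPoset_mem_finLinOrdPosets n⟩
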